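/- Let $\mathbb{Q}\langle a,b\rangle$ be the algebra of polynomials in two noncommuting variables. Let $u\mapsto u^*$ be the linear map that reverses every $ab$-word, and let $\Delta$ be the linear map with $\Delta(u_1\cdots u_n)=\sum_{i=1}^n u_1\cdots u_{i-1}\otimes u_{i+1}\cdots u_n$ on $ab$-words, written in Sweedler notation as $\Delta(u)=\sum_u u_{(1)}\otimes u_{(2)}$. The Ehrenborg--Readdy mixing operator is the bilinear operator $M$ given on $ab$-words by $$M(u,v)=\sum_{r=1}^{2}\sum_{s=1}^{2}\ \sum_{n\ge 2,\ n-r-s-1\text{ even}} M_{r,s,n}(u,v),$$ where $M_{1,2,2}(u,v)=u\cdot a\cdot v$, $M_{2,1,2}(u,v)=v\cdot b\cdot u$, $M_{1,s,n+1}(u,v)=\sum_u u_{(1)}\cdot a\cdot M_{2,s,n}(u_{(2)},v)$ and $M_{2,s,n+1}(u,v)=\sum_v v_{(1)}\cdot b\cdot M_{1,s,n}(u,v_{(2)})$ (only finitely many terms are nonzero). Define the linear operator $\mathcal{I}_2:\mathbb{Q}\langle a,b\rangle\to\mathbb{Q}\langle a,b\rangle$ by $$\mathcal{I}_2(u)=u+u^*+\sum_u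 M(u_{(1)}^*,u_{(2)}).$$ A finite graded poset is a finite poset with minimum $\hat 0$, maximum $\hat 1$ and a rank function $\rho$ with $\rho(\hat 0)=0$ and $\rho(y)=\rho(x)+1$ whenever $y$ covers $x$. If $P$ is such a poset, of rank $n+1$ with $n\ge 0$, let $f_S$ be the number of chains of $P$ whose set of ranks is $S\subseteq\{1,\ldots,n\}$, let $u_S=u_1\cdots u_n$ with $u_i=b$ for $i\in S$ and $u_i=a$ for $i\notin S$, put $\Upsilon_P(a,b)=\sum_{S\subseteq\{1,\ldots,n\}} f_S u_S$, and let $\Psi_P(a,b)=\Upsilon_P(a-b,b)$ be the $ab$-index of $P$. Let $\widehat{I}(P)$ be the graded poset of all intervals of $P$, including the empty one, ordered by inclusion. The total $ab$-index of the interval transform of the second kind of $P$ is $$\sum_{x\in P}\Psi_{[[x,x],[\hat 0,\hat 1]]}(a,b),$$ where $[[x,x],[\hat 0,\hat 1]]$ is an interval of $\widehat{I}(P)$. (1) For every finite graded poset $P$ of rank $n+1$, $n\ge 0$, this total $ab$-index is equal to $\mathcal{I}_2(\Psi_P(a,b))$. (2) Every $u\in\mathbb{Q}\langle a,b\rangle$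 with $u^*=-u$ satisfies $\mathcal{I}_2(u)=0$. -/

import Mathlib

open scoped TensorProduct

noncomputable section

namespace IntervalTransform

/-! ### The algebra `ℚ⟨a, b⟩` -/

/-- The algebra `ℚ⟨a, b⟩` of polynomials in two noncommuting variables. -/
abbrev AB : Type := FreeAlgebra ℚ (Fin 2)

/-- The variable `a`. -/
abbrev a : AB := FreeAlgebra.ι ℚ 0

/-- The variable `b`. -/
abbrev b : AB := FreeAlgebra.ι ℚ 1

/-- The monomial of an `ab`-word; the letter `0` stands for `a` and the letter `1` for `b`. -/
def word (w : List (Fin 2)) : AB := (w.map (FreeAlgebra.ι ℚ)).prod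

/-- The basis of `ℚ⟨a, b⟩` that consists of the `ab`-words. -/
abbrev wordBasis : Module.Basis (FreeMonoid (Fin 2)) ℚ AB := FreeAlgebra.basisFreeMonoid ℚ (Fin 2)

theorem wordBasis_apply (w : List (Fin 2)) : wordBasis (FreeMonoid.ofList w) = word w := by
  simp [wordBasis, word, FreeAlgebra.basisFreeMonoid, FreeAlgebra.equivMonoidAlgebraFreeMonoid,
    MonoidAlgebra.lift_single, FreeMonoid.lift_apply]

/-- The linear map `u ↦ u*` that reverses every `ab`-word. -/
def reversal : AB →ₗ[ℚ] AB where
  toFun u := star u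
  map_add' u v := star_add u v
  map_smul' c u := by
    simp [Algebra.smul_def, FreeAlgebra.star_algebraMap, Algebra.commutes]

theorem reversal_word (w : List (Fin 2)) : reversal (word w) = word w.reverse := by
  induction w with
  | nil => simp [reversal, word]
  | cons x w ih =>
    have h : word (x :: w) = FreeAlgebra.ι ℚ x * word w := by simp [word]
    have h2 : word (x :: w).reverse = word w.reverse * FreeAlgebra.ι ℚ x := by simp [word]
    rw [h, h2, ← ih]
    simp [reversal]

/-- The coproduct `Δ`, determined by
`Δ (u₁ ⋯ uₙ) = ∑ i, u₁ ⋯ uᵢ₋₁ ⊗ uᵢ₊₁ ⋯ uₙ` on `ab`-words. -/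
def coproduct : AB →ₗ[ℚ] AB ⊗[ℚ] AB :=
  wordBasis.constr ℚ fun w =>
    ∑ i ∈ Finset.range w.toList.length, word (w.toList.take i) ⊗ₜ[ℚ] word (w.toList.drop (i + 1))

theorem coproduct_word (w : List (Fin 2)) :
    coproduct (word w) =
      ∑ i ∈ Finset.range w.length, word (w.take i) ⊗ₜ[ℚ] word (w.drop (i + 1)) := by
  rw [← wordBasis_apply, coproduct, Module.Basis.constr_basis]
  rfl

/-! ### The mixing operator -/

/-- The element `M_{r,s,n}(u, v)` for `ab`-words `u` and `v`, where `n ≥ 2`, `r, s ∈ {1, 2}` and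
`n - r - s - 1` is even (the value is `0` for all other indices). It is given by
* `M_{1,2,2}(u, v) = u · a · v` and `M_{2,1,2}(u, v) = v · b · u`,
* `M_{1,s,n+1}(u, v) = ∑_u u₍₁₎ · a · M_{2,s,n}(u₍₂₎, v)`,
* `M_{2,s,n+1}(u, v) = ∑_v v₍₁₎ · b · M_{1,s,n}(u, v₍₂₎)`. -/
def mixingTerm (s : ℕ) : (n r : ℕ) → (u v : List (Fin 2)) → AB
  | 2, 1, u, v => if s = 2 then word u * a * word v else 0
  | 2, 2, u, v => if s = 1 then word v * b * word u else 0
  | n + 3, 1, u, v =>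
      ∑ i ∈ Finset.range u.length, word (u.take i) * a * mixingTerm s (n + 2) 2 (u.drop (i + 1)) v
  | n + 3, 2, u, v =>
      ∑ i ∈ Finset.range v.length, word (v.take i) * b * mixingTerm s (n + 2) 1 u (v.drop (i + 1))
  | _, _, _, _ => 0

/-- Only finitely many of the terms of the mixing operator are nonzero for a given pair of words. -/
theorem mixingTerm_eq_zero (s : ℕ) :
    ∀ (n r : ℕ) (u v : List (Fin 2)), u.length + v.length + 2 < n → mixingTerm s n r u v = 0
  | 0, _, _, _, h => by omega
  | 1, _, _, _, h => by omega
  | 2, _, _, _, h => by omega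
  | n + 3, 1, u, v, h => by
    rw [mixingTerm]
    refine Finset.sum_eq_zero fun i hi => ?_
    have hi := Finset.mem_range.1 hi
    rw [mixingTerm_eq_zero s (n + 2) 2 _ v (by rw [List.length_drop]; omega), mul_zero]
  | n + 3, 2, u, v, h => by
    rw [mixingTerm]
    refine Finset.sum_eq_zero fun i hi => ?_
    have hi := Finset.mem_range.1 hi
    rw [mixingTerm_eq_zero s (n + 2) 1 u _ (by rw [List.length_drop]; omega), mul_zero]
  | n + 3, 0, _, _, _ => by simp [mixingTerm]
  | n + 3, r + 3, _, _, _ => by simp [mixingTerm]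

/-- `M(u, v) = ∑_r ∑_s ∑_n M_{r,s,n}(u, v)` for `ab`-words `u` and `v`, where `n` runs over the
integers `n ≥ 2` such that `n - r - s - 1` is even; by `mixingTerm_eq_zero` the sum over `n` may be
cut off at `|u| + |v| + 2`. -/
def mixingWord (u v : List (Fin 2)) : AB :=
  ∑ r ∈ ({1, 2} : Finset ℕ), ∑ s ∈ ({1, 2} : Finset ℕ),
    ∑ n ∈ (Finset.Icc 2 (u.length + v.length + 2)).filter (fun n => Even (n + r + s + 1)),
      mixingTerm s n r u v

/-- The mixing operator `M` of Ehrenborg and Readdy: the bilinear extension of `mixingWord`. -/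
def mixing : AB →ₗ[ℚ] AB →ₗ[ℚ] AB :=
  wordBasis.constr ℚ fun u => wordBasis.constr ℚ fun v => mixingWord u.toList v.toList

theorem mixing_word (u v : List (Fin 2)) : mixing (word u) (word v) = mixingWord u v := by
  rw [← wordBasis_apply, ← wordBasis_apply, mixing, Module.Basis.constr_basis,
    Module.Basis.constr_basis]
  rfl

/-- The operator `II(u) = u + u* + ∑_u M(u₍₁₎*, u₍₂₎)`. -/
def II : AB →ₗ[ℚ] AB :=
  LinearMap.id + reversal + TensorProduct.lift (mixing ∘ₗ reversal) ∘ₗ coproduct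

/-! ### Flag `f`-vectors and the `ab`-index

A finite graded poset is a finite partial order with a minimum, a maximum, and a rank function
`grade ℕ` as in `GradeMinOrder ℕ P`: it is strictly monotone, it increases by exactly `1` along
covering relations, and it vanishes at the minimum. -/

/-- The entry `f_S` of the flag `f`-vector: the number of chains whose set of ranks is `S`. -/
def flagF (P : Type*) [PartialOrder P] [GradeMinOrder ℕ P] (S : Finset ℕ) : ℕ :=
  Nat.card {C : Finset P // IsChain (· ≤ ·) (C : Set P) ∧ C.image (grade ℕ) = S}

/-- The `ab`-word `u_S = u₁ ⋯ uₙ`, where `uᵢ = b` if `i ∈ S` and `uᵢ = a` otherwise. -/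
def rankWord (n : ℕ) (S : Finset ℕ) : List (Fin 2) :=
  (List.range n).map fun i => if i + 1 ∈ S then 1 else 0

/-- The upsilon invariant `Υ_P(a, b) = ∑_S f_S u_S` of a finite graded poset `P` of rank `n + 1`,
where `S` runs over the subsets of `{1, …, n}`. -/
def upsilon (P : Type*) [PartialOrder P] [OrderTop P] [GradeMinOrder ℕ P] : AB :=
  let n := grade ℕ (⊤ : P) - 1
  ∑ S ∈ (Finset.Icc 1 n).powerset, (flagF P S : ℚ) • word (rankWord n S)

/-- The `ab`-index `Ψ_P(a, b) = Υ_P(a - b, b)`. -/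
def abIndex (P : Type*) [PartialOrder P] [OrderTop P] [GradeMinOrder ℕ P] : AB :=
  FreeAlgebra.lift ℚ ![a - b, b] (upsilon P)

/-! ### The graded poset of intervals

`Interval P` is the poset of all intervals of `P`, including the empty one, ordered by inclusion. -/

/-- The rank in the graded poset of intervals: the empty interval has rank `0`, and `[u, v]` has
rank `ρ(v) - ρ(u) + 1`. -/
def intervalRank {P : Type*} [PartialOrder P] [GradeMinOrder ℕ P] : Interval P → ℕ
  | none => 0
  | some s => grade ℕ s.snd - grade ℕ s.fst + 1

theorem intervalRank_bot {P : Type*} [PartialOrder P] [GradeMinOrder ℕ P] :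
    intervalRank (⊥ : Interval P) = 0 := rfl

theorem intervalRank_coe {P : Type*} [PartialOrder P] [GradeMinOrder ℕ P]
    (s : NonemptyInterval P) :
    intervalRank (s : Interval P) = grade ℕ s.snd - grade ℕ s.fst + 1 := rfl

theorem coe_le_coe_iff {P : Type*} [PartialOrder P] (s t : NonemptyInterval P) :
    (s : Interval P) ≤ (t : Interval P) ↔ t.fst ≤ s.fst ∧ s.snd ≤ t.snd :=
  WithBot.coe_le_coe.trans NonemptyInterval.le_def

theorem intervalRank_strictMono {P : Type*} [PartialOrder P] [GradeMinOrder ℕ P] :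
    StrictMono (intervalRank : Interval P → ℕ) := by
  have hm : Monotone (grade ℕ : P → ℕ) := grade_strictMono.monotone
  intro x y
  induction x using Interval.recBotCoe with
  | bot =>
    induction y using Interval.recBotCoe with
    | bot => intro h; exact absurd h (lt_irrefl _)
    | coe t => intro _; rw [intervalRank_bot, intervalRank_coe]; omega
  | coe s =>
    induction y using Interval.recBotCoe with
    | bot => intro h; exact absurd h not_lt_bot
    | coe t =>
      intro h
      obtain ⟨h1, h2⟩ := (coe_le_coe_iff s t).1 h.le
      have h3 : ¬ (s.fst ≤ t.fst ∧ t.snd ≤ s.snd) := fun h' =>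
        h.not_ge ((coe_le_coe_iff t s).2 h')
      rw [intervalRank_coe, intervalRank_coe]
      have e1 := hm h1
      have e2 := hm h2
      have e3 := hm s.fst_le_snd
      have e4 : grade ℕ t.fst < grade ℕ s.fst ∨ grade ℕ s.snd < grade ℕ t.snd := by
        by_contra hc
        push Not at hc
        refine h3 ⟨?_, ?_⟩
        · rcases h1.lt_or_eq with hl | hl
          · exact absurd (grade_strictMono hl) (not_lt.2 hc.1)
          · exact hl.ge
        · rcases h2.lt_or_eq with hl | hl
          · exact absurd (grade_strictMono hl) (not_lt.2 hc.2)
          · exact hl.ge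
      omega

theorem intervalRank_covBy {P : Type*} [PartialOrder P] [GradeMinOrder ℕ P]
    {x y : Interval P} (h : x ⋖ y) : intervalRank x ⋖ intervalRank y := by
  have hm : Monotone (grade ℕ : P → ℕ) := grade_strictMono.monotone
  rw [Nat.covBy_iff_add_one_eq]
  induction y using Interval.recBotCoe with
  | bot => exact absurd h.lt not_lt_bot
  | coe t =>
    induction x using Interval.recBotCoe with
    | bot =>
      have h1 : ((NonemptyInterval.pure t.fst : NonemptyInterval P) : Interval P) ≤ t :=
        (coe_le_coe_iff _ _).2 ⟨le_rfl, t.fst_le_snd⟩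
      have h3 : t.snd ≤ t.fst := by
        by_contra hc
        have hlt : ((NonemptyInterval.pure t.fst : NonemptyInterval P) : Interval P) < t :=
          lt_of_le_not_ge h1 fun h' => hc ((coe_le_coe_iff _ _).1 h').2
        exact h.2 (WithBot.bot_lt_coe _) hlt
      have := hm h3
      rw [intervalRank_bot, intervalRank_coe]
      omega
    | coe s =>
      obtain ⟨h1, h2⟩ := (coe_le_coe_iff s t).1 h.le
      have e1 := hm h1
      have e2 := hm h2
      have e3 := hm s.fst_le_snd
      rw [intervalRank_coe, intervalRank_coe]
      rcases h1.lt_or_eq with hl | hl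
      · -- the left end point moves, so the right one does not
        let m : NonemptyInterval P := ⟨(t.fst, s.snd), h1.trans s.fst_le_snd⟩
        have hsm : (s : Interval P) < m :=
          lt_of_le_not_ge ((coe_le_coe_iff s m).2 ⟨h1, le_rfl⟩)
            fun h' => hl.not_ge ((coe_le_coe_iff m s).1 h').1
        have hmt : (m : Interval P) ≤ t := (coe_le_coe_iff m t).2 ⟨le_rfl, h2⟩
        have hs : t.snd ≤ s.snd := by
          by_contra hc
          exact h.2 hsm (lt_of_le_not_ge hmt fun h' => hc ((coe_le_coe_iff t m).1 h').2)
        have hc : t.fst ⋖ s.fst := by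
          refine ⟨hl, fun c hc1 hc2 => ?_⟩
          let k : NonemptyInterval P := ⟨(c, s.snd), hc2.le.trans s.fst_le_snd⟩
          have hk1 : (s : Interval P) < k :=
            lt_of_le_not_ge ((coe_le_coe_iff s k).2 ⟨hc2.le, le_rfl⟩)
              fun h' => hc2.not_ge ((coe_le_coe_iff k s).1 h').1
          have hk2 : (k : Interval P) < t :=
            lt_of_le_not_ge ((coe_le_coe_iff k t).2 ⟨hc1.le, h2⟩)
              fun h' => hc1.not_ge ((coe_le_coe_iff t k).1 h').1
          exact h.2 hk1 hk2
        have e5 := Nat.covBy_iff_add_one_eq.1 (hc.grade ℕ)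
        have e6 := hm hs
        omega
      · have hl2 : s.snd < t.snd := by
          refine lt_of_le_not_ge h2 fun h' => ?_
          exact h.lt.not_ge ((coe_le_coe_iff t s).2 ⟨hl.ge, h'⟩)
        have hc : s.snd ⋖ t.snd := by
          refine ⟨hl2, fun c hc1 hc2 => ?_⟩
          let k : NonemptyInterval P := ⟨(s.fst, c), s.fst_le_snd.trans hc1.le⟩
          have hk1 : (s : Interval P) < k :=
            lt_of_le_not_ge ((coe_le_coe_iff s k).2 ⟨le_rfl, hc1.le⟩)
              fun h' => hc1.not_ge ((coe_le_coe_iff k s).1 h').2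
          have hk2 : (k : Interval P) < t :=
            lt_of_le_not_ge ((coe_le_coe_iff k t).2 ⟨h1, hc2.le⟩)
              fun h' => hc2.not_ge ((coe_le_coe_iff t k).1 h').2
          exact h.2 hk1 hk2
        have e5 := Nat.covBy_iff_add_one_eq.1 (hc.grade ℕ)
        rw [← hl] at e3 ⊢
        omega

/-- The graded poset of intervals of a graded poset. -/
instance instGradeInterval {P : Type*} [PartialOrder P] [GradeMinOrder ℕ P] :
    GradeMinOrder ℕ (Interval P) where
  grade := intervalRank
  grade_strictMono := intervalRank_strictMono
  covBy_grade _ _ h := intervalRank_covBy h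
  isMin_grade x hx := by
    rw [isMin_iff_eq_bot.1 hx, intervalRank_bot]
    exact isMin_bot

/-- An interval `[x, y]` of a graded poset, as a graded poset with rank `z ↦ ρ(z) - ρ(x)`. -/
instance instGradeIcc {P : Type*} [PartialOrder P] [GradeMinOrder ℕ P] (x y : P)
    [Fact (x ≤ y)] : GradeMinOrder ℕ (Set.Icc x y) where
  grade z := grade ℕ (z : P) - grade ℕ x
  grade_strictMono z w h := by
    have h1 : grade ℕ (z : P) < grade ℕ (w : P) := grade_strictMono h
    have h2 : grade ℕ x ≤ grade ℕ (z : P) := grade_strictMono.monotone z.2.1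
    show grade ℕ (z : P) - grade ℕ x < grade ℕ (w : P) - grade ℕ x
    omega
  covBy_grade z w h := by
    have hc : (z : P) ⋖ (w : P) :=
      ⟨h.lt, fun c h1 h2 =>
        h.2 (c := ⟨c, z.2.1.trans h1.le, h2.le.trans w.2.2⟩) h1 h2⟩
    have h1 := Nat.covBy_iff_add_one_eq.1 (hc.grade ℕ)
    have h2 : grade ℕ x ≤ grade ℕ (z : P) := grade_strictMono.monotone z.2.1
    rw [Nat.covBy_iff_add_one_eq]
    omega
  isMin_grade z hz := by
    have : (z : P) = x := le_antisymm (hz (b := ⟨x, le_rfl, Fact.out⟩) z.2.1) z.2.1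
    rw [this, Nat.sub_self]
    exact isMin_bot

instance instFactPureLeTop {P : Type*} [PartialOrder P] [BoundedOrder P] (x : P) :
    Fact (Interval.pure x ≤ (⊤ : Interval P)) := ⟨le_top⟩

/-- In a graded poset of rank `n + 1` all intervals `[[x, x], [0̂, 1̂]]` have rank `n + 1`. -/
theorem grade_top_Icc_pure {P : Type*} [PartialOrder P] [BoundedOrder P] [GradeMinOrder ℕ P]
    (x : P) : grade ℕ (⊤ : Set.Icc (Interval.pure x) (⊤ : Interval P)) = grade ℕ (⊤ : P) := by
  have h : grade ℕ (⊥ : P) = 0 := Nat.le_zero.1 ((isMin_bot.grade ℕ) (Nat.zero_le _))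
  show (grade ℕ (⊤ : P) - grade ℕ (⊥ : P) + 1) - (grade ℕ x - grade ℕ x + 1) = _
  omega

/-- The total `ab`-index of the interval transform of the second kind of `P`: the sum over `x ∈ P`
of the `ab`-indices of the intervals `[[x, x], [0̂, 1̂]]` of the graded poset of intervals of `P`. -/
def totalABIndex (P : Type*) [PartialOrder P] [BoundedOrder P] [Fintype P] [GradeMinOrder ℕ P] :
    AB :=
  ∑ x : P, abIndex (Set.Icc (Interval.pure x) (⊤ : Interval P))

end IntervalTransform

end

noncomputable section

namespace IntervalTransform

/-! Substituting `a - b` for `a` in Υ gives every chain its own monomial, with `b` at the ranks of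
the chain and `a - b` elsewhere. Hence Ψ is a transfer-matrix sum. If `Z x y = (a - b)^(ρ(y) - ρ(x)
- 1)` for `x < y` and `0` otherwise, the solution of `A = Z + Z b A` has entries `A x y = Ψ_[x,y]`.
As Δ kills polynomials in `a - b`, it cuts chains at their elements: `Δ(A x y) = ∑ z, A x z ⊗ A z y`
(`IsTransfer.coproduct_apply`).

The intervals that contain `x` are the pairs above `(x, x)` in the product of the dual of `P` and
`P`. By `IsTransfer.prodChains_eq`, `M` with two boundary terms solves the transfer equation of a
product. So the interval `[[x, x], [0̂, 1̂]]` contributes `M(A(0̂, x)*, A(x, 1̂))`, plus `Ψ*` if `x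
= 1̂` and `Ψ` if `x = 0̂`. Summing over `x` and reading the first terms as Δ of Ψ gives (1).

For (2), the product equation is symmetric in its factors and has only one solution, so `M` is
commutative on entries of transfer matrices. These span the algebra. Hence the `M`-term of the
operator takes the same value at `u` and `u*`, and it vanishes if `u* = -u`. -/

/-! ### Recursions for the mixing operator -/

theorem mixingTerm_eq_zero_of_odd (s : ℕ) :
    ∀ (n r : ℕ) (u v : List (Fin 2)), ¬ Even (n + r + s + 1) → mixingTerm s n r u v = 0
  | 0, _, _, _, _ => by simp [mixingTerm]
  | 1, _, _, _, _ => by simp [mixingTerm]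
  | 2, 0, _, _, _ => by simp [mixingTerm]
  | 2, 1, _, _, h => by
    rw [mixingTerm, if_neg]
    rintro rfl
    exact h (by decide)
  | 2, 2, _, _, h => by
    rw [mixingTerm, if_neg]
    rintro rfl
    exact h (by decide)
  | 2, r + 3, _, _, _ => by simp [mixingTerm]
  | n + 3, 1, u, v, h => by
    rw [mixingTerm]
    refine Finset.sum_eq_zero fun i _ => ?_
    rw [mixingTerm_eq_zero_of_odd s (n + 2) 2 _ v (by grind), mul_zero]
  | n + 3, 2, u, v, h => by
    rw [mixingTerm]
    refine Finset.sum_eq_zero fun i _ => ?_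
    rw [mixingTerm_eq_zero_of_odd s (n + 2) 1 u _ (by grind), mul_zero]
  | n + 3, 0, _, _, _ => by simp [mixingTerm]
  | n + 3, r + 3, _, _, _ => by simp [mixingTerm]

/-- The part of the mixing operator with a fixed first index `r`. -/
def mixingPart (r : ℕ) (u v : List (Fin 2)) : AB :=
  ∑ s ∈ ({1, 2} : Finset ℕ), ∑ n ∈ Finset.range (u.length + v.length + 1), mixingTerm s (n + 2) r u v

theorem sum_mixingTerm_of_le (s r N : ℕ) (u v : List (Fin 2)) (h : u.length + v.length + 1 ≤ N) :
    ∑ n ∈ Finset.range N, mixingTerm s (n + 2) r u v =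
      ∑ n ∈ Finset.range (u.length + v.length + 1), mixingTerm s (n + 2) r u v := by
  symm
  refine Finset.sum_subset (Finset.range_subset_range.2 h) fun n _ hn => ?_
  refine mixingTerm_eq_zero _ _ _ _ _ ?_
  simp only [Finset.mem_range] at hn
  omega

theorem mixingPart_eq (r N : ℕ) (u v : List (Fin 2)) (h : u.length + v.length + 1 ≤ N) :
    mixingPart r u v =
      ∑ s ∈ ({1, 2} : Finset ℕ), ∑ n ∈ Finset.range N, mixingTerm s (n + 2) r u v :=
  Finset.sum_congr rfl fun s _ => (sum_mixingTerm_of_le s r N u v h).symm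

/-- The parity condition discards only zeros: each step of the recursion lowers `n` by one and
switches `r`, and it ends at `n = 2` with `r + s = 3`. -/
theorem mixingWord_eq (u v : List (Fin 2)) :
    mixingWord u v = mixingPart 1 u v + mixingPart 2 u v := by
  have h : ∀ r s, ∑ n ∈ (Finset.Icc 2 (u.length + v.length + 2)).filter
      (fun n => Even (n + r + s + 1)), mixingTerm s n r u v =
      ∑ n ∈ Finset.range (u.length + v.length + 1), mixingTerm s (n + 2) r u v := by
    intro r s
    rw [Finset.sum_filter_of_ne fun n _ hn => by
      by_contra hc
      exact hn (mixingTerm_eq_zero_of_odd s n r u v hc)]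
    rw [Finset.range_eq_Ico, Finset.sum_Ico_add' (fun n => mixingTerm s n r u v) 0 _ 2]
    refine Finset.sum_congr ?_ fun _ _ => rfl
    ext n
    simp only [Finset.mem_Icc, Finset.mem_Ico]
    omega
  simp only [mixingWord, h]
  rw [Finset.sum_pair (by decide)]
  rfl

/-- The summand `n = 2` survives only for `s = 2` and yields the first term; a shift of `n` by one
turns the others into parts with `r = 2`. The shorter words on the right allow a common range for
`n`. -/
theorem mixingPart_one (u v : List (Fin 2)) :
    mixingPart 1 u v = word u * a * word v +
      ∑ i ∈ Finset.range u.length, word (u.take i) * a * mixingPart 2 (u.drop (i + 1)) v := by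
  rw [mixingPart_eq 1 (u.length + v.length + 1 + 1) u v (by omega)]
  have h : ∀ i ∈ Finset.range u.length, word (u.take i) * a * mixingPart 2 (u.drop (i + 1)) v =
      ∑ s ∈ ({1, 2} : Finset ℕ), ∑ n ∈ Finset.range (u.length + v.length + 1),
        word (u.take i) * a * mixingTerm s (n + 2) 2 (u.drop (i + 1)) v := by
    intro i _
    rw [mixingPart_eq 2 (u.length + v.length + 1) _ v (by simp)]
    simp only [Finset.mul_sum]
  rw [Finset.sum_congr rfl h, Finset.sum_comm (s := Finset.range _)]
  simp only [Finset.sum_range_succ' _ (u.length + v.length + 1), Finset.sum_add_distrib]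
  rw [add_comm]
  congr 1
  · simp [mixingTerm]
  · refine Finset.sum_congr rfl fun s _ => ?_
    rw [Finset.sum_comm]
    refine Finset.sum_congr rfl fun n _ => ?_
    rw [mixingTerm]

theorem mixingPart_two (u v : List (Fin 2)) :
    mixingPart 2 u v = word v * b * word u +
      ∑ i ∈ Finset.range v.length, word (v.take i) * b * mixingPart 1 u (v.drop (i + 1)) := by
  rw [mixingPart_eq 2 (u.length + v.length + 1 + 1) u v (by omega)]
  have h : ∀ i ∈ Finset.range v.length, word (v.take i) * b * mixingPart 1 u (v.drop (i + 1)) =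
      ∑ s ∈ ({1, 2} : Finset ℕ), ∑ n ∈ Finset.range (u.length + v.length + 1),
        word (v.take i) * b * mixingTerm s (n + 2) 1 u (v.drop (i + 1)) := by
    intro i _
    rw [mixingPart_eq 1 (u.length + v.length + 1) u _ (by simp)]
    simp only [Finset.mul_sum]
  rw [Finset.sum_congr rfl h, Finset.sum_comm (s := Finset.range _)]
  simp only [Finset.sum_range_succ' _ (u.length + v.length + 1), Finset.sum_add_distrib]
  rw [add_comm]
  congr 1
  · simp [mixingTerm]
  · refine Finset.sum_congr rfl fun s _ => ?_
    rw [Finset.sum_comm]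
    refine Finset.sum_congr rfl fun n _ => ?_
    rw [mixingTerm]

/-- The bilinear extension of `mixingPart`. -/
def mix (r : ℕ) : AB →ₗ[ℚ] AB →ₗ[ℚ] AB :=
  wordBasis.constr ℚ fun u => wordBasis.constr ℚ fun v => mixingPart r u.toList v.toList

theorem mix_word (r : ℕ) (u v : List (Fin 2)) : mix r (word u) (word v) = mixingPart r u v := by
  rw [← wordBasis_apply, ← wordBasis_apply, mix, Module.Basis.constr_basis,
    Module.Basis.constr_basis]
  rfl

/-- Linear maps that agree on words are equal. -/
theorem hom_ext_word {V : Type*} [AddCommMonoid V] [Module ℚ V] {f g : AB →ₗ[ℚ] V}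
    (h : ∀ w, f (word w) = g (word w)) : f = g :=
  wordBasis.ext fun w => by
    have := h w.toList
    rwa [← wordBasis_apply] at this

theorem mixing_eq_add : mixing = mix 1 + mix 2 :=
  hom_ext_word fun u => hom_ext_word fun v => by
    simp only [LinearMap.add_apply, mix_word, mixing_word, mixingWord_eq]

theorem mix_one (v : AB) :
    (mix 1).flip v = LinearMap.mulRight ℚ (a * v) + TensorProduct.lift
      ((LinearMap.mul ℚ AB).compl₂ (LinearMap.mulLeft ℚ a ∘ₗ (mix 2).flip v)) ∘ₗ coproduct := by
  refine hom_ext_word fun u => ?_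
  have h : mix 1 (word u) = LinearMap.mulLeft ℚ (word u * a) + ∑ i ∈ Finset.range u.length,
      LinearMap.mulLeft ℚ (word (u.take i) * a) ∘ₗ mix 2 (word (u.drop (i + 1))) :=
    hom_ext_word fun v => by simp [mix_word, mixingPart_one, mul_assoc]
  simp [h, coproduct_word, mul_assoc]

theorem mix_two (u : AB) :
    mix 2 u = LinearMap.mulRight ℚ (b * u) + TensorProduct.lift
      ((LinearMap.mul ℚ AB).compl₂ (LinearMap.mulLeft ℚ b ∘ₗ mix 1 u)) ∘ₗ coproduct := by
  refine hom_ext_word fun v => ?_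
  have h : (mix 2).flip (word v) = LinearMap.mulLeft ℚ (word v * b) + ∑ i ∈ Finset.range v.length,
      LinearMap.mulLeft ℚ (word (v.take i) * b) ∘ₗ (mix 1).flip (word (v.drop (i + 1))) :=
    hom_ext_word fun u => by simp [mix_word, mixingPart_two, mul_assoc]
  have h' := LinearMap.congr_fun h u
  rw [LinearMap.flip_apply] at h'
  simp [h', coproduct_word, mul_assoc]

/-- Any expression of the coproduct as a sum of tensors may be used; for entries of a transfer
matrix it will be a sum over the index set. -/
theorem mix_one_of_coproduct_eq {ι : Type*} (s : Finset ι) (p q : ι → AB) (u v : AB)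
    (h : coproduct u = ∑ i ∈ s, p i ⊗ₜ[ℚ] q i) :
    mix 1 u v = u * a * v + ∑ i ∈ s, p i * a * mix 2 (q i) v := by
  have := LinearMap.congr_fun (mix_one v) u
  rw [LinearMap.flip_apply] at this
  simp [this, h, mul_assoc]

theorem mix_two_of_coproduct_eq {ι : Type*} (s : Finset ι) (p q : ι → AB) (u v : AB)
    (h : coproduct v = ∑ i ∈ s, p i ⊗ₜ[ℚ] q i) :
    mix 2 u v = v * b * u + ∑ i ∈ s, p i * b * mix 1 u (q i) := by
  simp [LinearMap.congr_fun (mix_two u) v, h, mul_assoc]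

/-! ### The coproduct and polynomials in `a - b` -/

theorem coproduct_one : coproduct 1 = 0 := by
  simpa [word] using coproduct_word []

theorem coproduct_ι_mul (x : Fin 2) (u : AB) :
    coproduct (FreeAlgebra.ι ℚ x * u) =
      1 ⊗ₜ[ℚ] u + (FreeAlgebra.ι ℚ x ⊗ₜ[ℚ] (1 : AB)) * coproduct u := by
  have h : coproduct ∘ₗ LinearMap.mulLeft ℚ (FreeAlgebra.ι ℚ x) =
      TensorProduct.mk ℚ AB AB 1 +
        LinearMap.mulLeft ℚ (FreeAlgebra.ι ℚ x ⊗ₜ[ℚ] (1 : AB)) ∘ₗ coproduct := by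
    refine hom_ext_word fun w => ?_
    have hw : FreeAlgebra.ι ℚ x * word w = word (x :: w) := by simp [word]
    simp only [LinearMap.comp_apply, LinearMap.mulLeft_apply, LinearMap.add_apply,
      TensorProduct.mk_apply]
    rw [hw, coproduct_word, coproduct_word, List.length_cons, Finset.sum_range_succ', add_comm,
      Finset.mul_sum]
    simp [word, Algebra.TensorProduct.tmul_mul_tmul]
  simpa using LinearMap.congr_fun h u

/-- Both letters contribute the same term `1 ⊗ u`, which cancels. -/
theorem coproduct_sub_mul (u : AB) :
    coproduct ((a - b) * u) = ((a - b) ⊗ₜ[ℚ] (1 : AB)) * coproduct u := by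
  rw [sub_mul, map_sub, coproduct_ι_mul, coproduct_ι_mul, TensorProduct.sub_tmul, sub_mul]
  abel

/-- The subalgebra of polynomials in `a - b`. -/
abbrev diffAlg : Subalgebra ℚ AB := Algebra.adjoin ℚ {a - b}

theorem coproduct_mul_of_mem {z : AB} (hz : z ∈ diffAlg) (u : AB) :
    coproduct (z * u) = (z ⊗ₜ[ℚ] (1 : AB)) * coproduct u := by
  induction hz using Algebra.adjoin_induction generalizing u with
  | mem x hx =>
    rw [Set.mem_singleton_iff.1 hx]
    exact coproduct_sub_mul u
  | algebraMap r =>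
    rw [← Algebra.smul_def, map_smul, Algebra.algebraMap_eq_smul_one, ← TensorProduct.smul_tmul',
      smul_mul_assoc, ← Algebra.TensorProduct.one_def, one_mul]
  | add x y _ _ hx hy => rw [add_mul, map_add, hx, hy, TensorProduct.add_tmul, add_mul]
  | mul x y _ _ hx hy =>
    rw [mul_assoc, hx, hy, ← mul_assoc, Algebra.TensorProduct.tmul_mul_tmul, one_mul]

theorem coproduct_of_mem {z : AB} (hz : z ∈ diffAlg) : coproduct z = 0 := by
  have := coproduct_mul_of_mem hz 1
  rwa [mul_one, coproduct_one, mul_zero] at this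

theorem mul_comm_of_mem {z w : AB} (hz : z ∈ diffAlg) (hw : w ∈ diffAlg) : z * w = w * z := by
  have := Algebra.isMulCommutative_adjoin ℚ (s := {a - b}) (by simp)
  exact congrArg Subtype.val (mul_comm' (⟨z, hz⟩ : diffAlg) ⟨w, hw⟩)

theorem sub_mem_diffAlg : a - b ∈ diffAlg := Algebra.subset_adjoin rfl

theorem reversal_mul (u v : AB) : reversal (u * v) = reversal v * reversal u := star_mul u v

theorem reversal_of_mem {z : AB} (hz : z ∈ diffAlg) : reversal z = z := by
  induction hz using Algebra.adjoin_induction with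
  | mem x hx =>
    rw [Set.mem_singleton_iff.1 hx]
    simp [reversal]
  | algebraMap r => exact FreeAlgebra.star_algebraMap r
  | add x y _ _ hx hy => rw [map_add, hx, hy]
  | mul x y hx' hy' hx hy => rw [reversal_mul, hx, hy, mul_comm_of_mem hx' hy']

theorem reversal_b : reversal b = b := FreeAlgebra.star_ι 1

open Matrix

/-! ### Strictly triangular matrices -/

section Triangular

variable {I : Type*} [Fintype I] {R : Type*} [Ring R]

/-- `X` raises the bounded function `r`, so it is nilpotent. This is the uniqueness principle behind
the later identities: the difference of two solutions of one recursion is such a `D`. -/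
theorem eq_zero_of_eq_mul {X D : Matrix I I R} {r : I → ℕ}
    (hX : ∀ x y, X x y ≠ 0 → r x < r y) (hD : D = X * D) : D = 0 := by
  obtain ⟨N, hN⟩ : ∃ N, ∀ x, r x ≤ N :=
    ⟨Finset.univ.sup r, fun x => Finset.le_sup (Finset.mem_univ x)⟩
  -- Downward induction on `r x`, with `k` counting the distance from the bound.
  have key : ∀ k x y, N < r x + k → D x y = 0 := by
    intro k
    induction k with
    | zero => intro x y h; exact absurd (hN x) (by omega)
    | succ k ih =>
      intro x y h
      rw [hD, Matrix.mul_apply]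
      refine Finset.sum_eq_zero fun z _ => ?_
      by_cases hz : X x z = 0
      · rw [hz, zero_mul]
      · rw [ih z y (by have := hX x z hz; omega), mul_zero]
  ext x y
  exact key (N + 1) x y (by omega)

theorem pow_apply_eq_zero [DecidableEq I] {X : Matrix I I R} {r : I → ℕ}
    (hX : ∀ x y, X x y ≠ 0 → r x < r y) (k : ℕ) (x y : I) (h : r y < r x + k) :
    (X ^ k) x y = 0 := by
  induction k generalizing x with
  | zero =>
    rw [pow_zero, Matrix.one_apply_ne]
    rintro rfl
    omega
  | succ k ih =>
    rw [pow_succ', Matrix.mul_apply]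
    refine Finset.sum_eq_zero fun z _ => ?_
    by_cases hz : X x z = 0
    · rw [hz, zero_mul]
    · rw [ih z (by have := hX x z hz; omega), mul_zero]

theorem exists_eq_add_mul [DecidableEq I] {X : Matrix I I R} {r : I → ℕ}
    (hX : ∀ x y, X x y ≠ 0 → r x < r y) (Z : Matrix I I R) :
    ∃ A : Matrix I I R, A = Z + X * A := by
  obtain ⟨N, hN⟩ : ∃ N, ∀ x, r x ≤ N :=
    ⟨Finset.univ.sup r, fun x => Finset.le_sup (Finset.mem_univ x)⟩
  have hp : X ^ (N + 1) = 0 := by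
    ext x y
    exact pow_apply_eq_zero hX _ x y (by have := hN y; omega)
  refine ⟨(∑ i ∈ Finset.range (N + 1), X ^ i) * Z, ?_⟩
  have h := congrArg (· * Z) (mul_neg_geom_sum X (N + 1))
  simp only [hp, sub_zero, one_mul, sub_mul] at h
  rw [← mul_assoc]
  exact sub_eq_iff_eq_add.1 h

theorem mul_scalar_mul_apply [DecidableEq I] {K L : Type*} (X : Matrix K I R) (c : R)
    (Y : Matrix I L R) (x : K) (y : L) :
    (X * scalar I c * Y) x y = ∑ z, X x z * c * Y z y := by
  simp [Matrix.mul_apply (N := Y), scalar_apply, mul_diagonal]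

end Triangular

/-! ### Transfer matrices -/

section Transfer

variable {I : Type*} [Fintype I] [DecidableEq I]

/-- `A` is the matrix of the sums over all chains from one index to another, where the steps of a
chain are weighted by the entries of the strictly triangular matrix `Z`, which are polynomials in
`a - b`, and its inner elements by `b`. -/
structure IsTransfer (Z A : Matrix I I AB) (r : I → ℕ) : Prop where
  mem : ∀ x y, Z x y ∈ diffAlg
  lt : ∀ x y, Z x y ≠ 0 → r x < r y
  eq : A = Z + Z * scalar I b * A

theorem exists_isTransfer {Z : Matrix I I AB} {r : I → ℕ} (hm : ∀ x y, Z x y ∈ diffAlg)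
    (hr : ∀ x y, Z x y ≠ 0 → r x < r y) : ∃ A, IsTransfer Z A r := by
  obtain ⟨A, hA⟩ := exists_eq_add_mul (X := Z * scalar I b) (r := r) (fun x y h => hr x y fun h0 => h
    (by simp [scalar_apply, mul_diagonal, h0])) Z
  exact ⟨A, hm, hr, hA⟩

namespace IsTransfer

variable {Z A : Matrix I I AB} {r : I → ℕ}

theorem mul_scalar_lt (h : IsTransfer Z A r) (x y : I) (hxy : (Z * scalar I b) x y ≠ 0) :
    r x < r y :=
  h.lt x y fun h0 => hxy (by simp [scalar_apply, mul_diagonal, h0])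

theorem apply (h : IsTransfer Z A r) (x y : I) : A x y = Z x y + ∑ z, Z x z * b * A z y := by
  conv_lhs => rw [h.eq, Matrix.add_apply, mul_scalar_mul_apply]

/-- Chains may also be split at their last inner element; the difference of the two sides is fixed
by `Z b`. -/
theorem eq' (h : IsTransfer Z A r) : A = Z + A * scalar I b * Z := by
  refine sub_eq_zero.1 (eq_zero_of_eq_mul h.mul_scalar_lt ?_)
  have h1 : Z * scalar I b * A = A - Z := eq_sub_of_add_eq' h.eq.symm
  have h2 : Z * scalar I b * (A * scalar I b * Z) = (Z * scalar I b * A) * scalar I b * Z := by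
    simp only [mul_assoc]
  rw [mul_sub, mul_add, h2, h1]
  noncomm_ring

theorem eq_zero (h : IsTransfer Z A r) {x y : I} (hxy : r y ≤ r x) : A x y = 0 := by
  obtain ⟨N, hN⟩ : ∃ N, ∀ x, r x ≤ N :=
    ⟨Finset.univ.sup r, fun x => Finset.le_sup (Finset.mem_univ x)⟩
  have key : ∀ k x, r y ≤ r x → N < r x + k → A x y = 0 := by
    intro k
    induction k with
    | zero => intro x _ h; exact absurd (hN x) (by omega)
    | succ k ih =>
      intro x h1 h2
      have hz : Z x y = 0 := by
        by_contra hz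
        exact absurd (h.lt x y hz) (by omega)
      rw [h.apply, hz, zero_add]
      refine Finset.sum_eq_zero fun z _ => ?_
      by_cases hz : Z x z = 0
      · rw [hz, zero_mul, zero_mul]
      · have := h.lt x z hz
        rw [ih z (by omega) (by omega), mul_zero]
  exact key (N + 1) x hxy (by omega)

/-- Both sides satisfy the recursion obtained by removing the first step of a chain: Δ passes over
the factor `Z x z` and then either cuts at the `b` that follows it or moves on. -/
theorem coproduct_apply (h : IsTransfer Z A r) (x y : I) :
    coproduct (A x y) = ∑ z, A x z ⊗ₜ[ℚ] A z y := by
  let D : Matrix I I (AB ⊗[ℚ] AB) :=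
    of fun x y => coproduct (A x y) - ∑ z, A x z ⊗ₜ[ℚ] A z y
  have hD : D = 0 := by
    refine eq_zero_of_eq_mul (X := of fun x y => (Z x y * b) ⊗ₜ[ℚ] (1 : AB)) (r := r)
      (fun x y hxy => h.lt x y fun h0 => hxy (by simp [h0])) ?_
    ext x y
    have h1 : coproduct (A x y) =
        ∑ z, (Z x z ⊗ₜ[ℚ] A z y + ((Z x z * b) ⊗ₜ[ℚ] (1 : AB)) * coproduct (A z y)) := by
      rw [h.apply x y, map_add, coproduct_of_mem (h.mem x y), zero_add, map_sum]
      refine Finset.sum_congr rfl fun z _ => ?_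
      rw [mul_assoc, coproduct_mul_of_mem (h.mem x z), coproduct_ι_mul, mul_add, ← mul_assoc]
      simp only [Algebra.TensorProduct.tmul_mul_tmul, one_mul, mul_one]
    have h2 : ∑ z, A x z ⊗ₜ[ℚ] A z y =
        ∑ z, (Z x z ⊗ₜ[ℚ] A z y + ((Z x z * b) ⊗ₜ[ℚ] (1 : AB)) * ∑ w, A z w ⊗ₜ[ℚ] A w y) := by
      simp only [h.apply x, TensorProduct.add_tmul, TensorProduct.sum_tmul,
        Finset.sum_add_distrib, Finset.mul_sum, Algebra.TensorProduct.tmul_mul_tmul, one_mul]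
      rw [Finset.sum_comm]
    simp only [D, of_apply, Matrix.mul_apply]
    rw [h1, h2, ← Finset.sum_sub_distrib]
    exact Finset.sum_congr rfl fun z _ => by rw [mul_sub]; abel
  exact sub_eq_zero.1 (congrFun (congrFun hD x) y)

/-- Reversal fixes `b` and polynomials in `a - b`, so it turns the recursion at the last step into
one at the first step. -/
theorem dual (h : IsTransfer Z A r) {s : I → ℕ} (hs : ∀ x y, r x < r y → s y < s x) :
    IsTransfer Zᵀ (A.map reversal)ᵀ s where
  mem x y := h.mem y x
  lt x y hxy := hs _ _ (h.lt y x hxy)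
  eq := by
    ext x y
    have h1 := congrArg reversal (congrFun (congrFun h.eq' y) x)
    rw [Matrix.add_apply, mul_scalar_mul_apply] at h1 ⊢
    simpa [reversal_mul, reversal_of_mem (h.mem _ _), reversal_b, mul_assoc] using h1

end IsTransfer

end Transfer

/-! ### Products -/

section Factors

variable {I J : Type*}

/-- A matrix acting on the first factor of a product. -/
def onFst (J : Type*) [DecidableEq J] (Z : Matrix I I AB) : Matrix (I × J) (I × J) AB :=
  blockDiagonal fun _ => Z

/-- A matrix acting on the second factor of a product. -/
def onSnd (I : Type*) [DecidableEq I] (W : Matrix J J AB) : Matrix (I × J) (I × J) AB :=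
  (blockDiagonal fun _ => W).submatrix Prod.swap Prod.swap

theorem onFst_apply [DecidableEq J] (Z : Matrix I I AB) (p q : I × J) :
    onFst J Z p q = if p.2 = q.2 then Z p.1 q.1 else 0 := rfl

theorem onSnd_apply [DecidableEq I] (W : Matrix J J AB) (p q : I × J) :
    onSnd I W p q = if p.1 = q.1 then W p.2 q.2 else 0 := rfl

theorem onFst_mul [Fintype I] [Fintype J] [DecidableEq J] (Z A : Matrix I I AB) :
    onFst J (Z * A) = onFst J Z * onFst J A :=
  blockDiagonal_mul _ _

theorem onSnd_mul [Fintype I] [DecidableEq I] [Fintype J] (W B : Matrix J J AB) :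
    onSnd I (W * B) = onSnd I W * onSnd I B := by
  rw [onSnd, blockDiagonal_mul]
  exact (submatrix_mul_equiv _ _ _ (Equiv.prodComm I J) _).symm

theorem onFst_scalar [Fintype I] [DecidableEq I] [Fintype J] [DecidableEq J] (c : AB) :
    onFst J (scalar I c) = scalar (I × J) c := by
  ext p q
  by_cases h1 : p.1 = q.1 <;> by_cases h2 : p.2 = q.2 <;>
    simp [onFst_apply, scalar_apply, diagonal_apply, Prod.ext_iff, h1, h2]

theorem onSnd_scalar [Fintype I] [DecidableEq I] [Fintype J] [DecidableEq J] (c : AB) :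
    onSnd I (scalar J c) = scalar (I × J) c := by
  ext p q
  by_cases h1 : p.1 = q.1 <;> by_cases h2 : p.2 = q.2 <;>
    simp [onSnd_apply, scalar_apply, diagonal_apply, Prod.ext_iff, h1, h2]

theorem onFst_add [DecidableEq J] (Z A : Matrix I I AB) : onFst J (Z + A) = onFst J Z + onFst J A :=
  blockDiagonal_add _ _

theorem onSnd_add [DecidableEq I] (W B : Matrix J J AB) : onSnd I (W + B) = onSnd I W + onSnd I B := by
  rw [onSnd, ← Pi.add_def, blockDiagonal_add]
  rfl

end Factors

variable {I : Type*} [DecidableEq I] {J : Type*} [DecidableEq J]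

/-- The step weights of a product. -/
def prodStep (Z : Matrix I I AB) (W : Matrix J J AB) : Matrix (I × J) (I × J) AB :=
  of fun p q => (if p.2 = q.2 then Z p.1 q.1 else 0) + (if p.1 = q.1 then W p.2 q.2 else 0) +
    Z p.1 q.1 * (a - b) * W p.2 q.2

/-- The sums over all chains of a product, in terms of the mixing operator. -/
def prodChains (A : Matrix I I AB) (B : Matrix J J AB) : Matrix (I × J) (I × J) AB :=
  of fun p q => mixing (A p.1 q.1) (B p.2 q.2) + (if p.2 = q.2 then A p.1 q.1 else 0) +
    (if p.1 = q.1 then B p.2 q.2 else 0)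

variable [Fintype I] [Fintype J]

theorem onFst_mul_mul_onSnd (Z : Matrix I I AB) (c : AB) (W : Matrix J J AB) :
    onFst J Z * scalar (I × J) c * onSnd I W = of fun p q => Z p.1 q.1 * c * W p.2 q.2 := by
  ext p q
  rw [mul_scalar_mul_apply]
  simp [onFst_apply, onSnd_apply, Fintype.sum_prod_type]

namespace IsTransfer

variable {Z A : Matrix I I AB} {r : I → ℕ} {W B : Matrix J J AB} {r' : J → ℕ}

/-- Each of the two parts of `M` absorbs one boundary term, giving `N₁ = A(1 + a N₂)` and `N₂ = B(1
+ b N₁)`. Eliminating `A` and `B` in favour of `Z` and `W` leaves `N = T(1 + b N)` for `N = N₁ + N₂`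
and `T = Z + W + Z(a - b)W`. -/
theorem prodChains_eq (h : IsTransfer Z A r) (h' : IsTransfer W B r') :
    prodChains A B =
      prodStep Z W + prodStep Z W * scalar (I × J) b * prodChains A B := by
  obtain ⟨N₁, hN₁⟩ : ∃ N₁ : Matrix (I × J) (I × J) AB, ∀ p q, N₁ p q =
      mix 1 (A p.1 q.1) (B p.2 q.2) + (if p.2 = q.2 then A p.1 q.1 else 0) := ⟨of _, fun _ _ => rfl⟩
  obtain ⟨N₂, hN₂⟩ : ∃ N₂ : Matrix (I × J) (I × J) AB, ∀ p q, N₂ p q =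
      mix 2 (A p.1 q.1) (B p.2 q.2) + (if p.1 = q.1 then B p.2 q.2 else 0) := ⟨of _, fun _ _ => rfl⟩
  have e1 : N₁ = onFst J A + onFst J A * scalar (I × J) a * N₂ := by
    ext p q
    rw [hN₁, mix_one_of_coproduct_eq _ _ _ _ _ (h.coproduct_apply p.1 q.1), Matrix.add_apply,
      mul_scalar_mul_apply]
    simp only [hN₂, onFst_apply, Fintype.sum_prod_type, mul_add, Finset.sum_add_distrib]
    simp [add_comm]
  have e2 : N₂ = onSnd I B + onSnd I B * scalar (I × J) b * N₁ := by
    ext p q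
    rw [hN₂, mix_two_of_coproduct_eq _ _ _ _ _ (h'.coproduct_apply p.2 q.2), Matrix.add_apply,
      mul_scalar_mul_apply]
    simp only [hN₁, onSnd_apply, Fintype.sum_prod_type_right, mul_add, Finset.sum_add_distrib]
    simp [add_comm]
  have eN : prodChains A B = N₁ + N₂ := by
    ext p q
    rw [Matrix.add_apply, hN₁, hN₂, prodChains, of_apply, mixing_eq_add, LinearMap.add_apply,
      LinearMap.add_apply]
    abel
  have eT : prodStep Z W = onFst J Z + onSnd I W +
      onFst J Z * (scalar (I × J) a - scalar (I × J) b) * onSnd I W := by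
    rw [← map_sub, onFst_mul_mul_onSnd]
    rfl
  have eA : onFst J A = onFst J Z + onFst J Z * scalar (I × J) b * onFst J A := by
    rw [← onFst_scalar, ← onFst_mul, ← onFst_mul, ← onFst_add, ← h.eq]
  have eB : onSnd I B = onSnd I W + onSnd I W * scalar (I × J) b * onSnd I B := by
    rw [← onSnd_scalar, ← onSnd_mul, ← onSnd_mul, ← onSnd_add, ← h'.eq]
  rw [eN, eT]
  generalize scalar (I × J) a = α at *
  generalize scalar (I × J) b = β at *
  have f1 : N₁ = onFst J Z * (1 + α * N₂ + β * N₁) := by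
    have : N₁ = (onFst J Z + onFst J Z * β * onFst J A) * (1 + α * N₂) := by
      rw [← eA]
      conv_lhs => rw [e1]
      noncomm_ring
    conv_lhs => rw [this]
    conv_rhs => rw [e1]
    noncomm_ring
  have f2 : N₂ = onSnd I W * (1 + β * N₁ + β * N₂) := by
    have : N₂ = (onSnd I W + onSnd I W * β * onSnd I B) * (1 + β * N₁) := by
      rw [← eB]
      conv_lhs => rw [e2]
      noncomm_ring
    conv_lhs => rw [this]
    conv_rhs => rw [e2]
    noncomm_ring
  -- The excess of `f1` over `Z(1 + b N)` is `Z(a - b)N₂`; by `f2` it supplies the steps that move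
  -- both coordinates.
  have f3 : onFst J Z * (α - β) * N₂ =
      onFst J Z * (α - β) * (onSnd I W * (1 + β * N₁ + β * N₂)) := by rw [← f2]
  calc N₁ + N₂ = onFst J Z * (1 + β * N₁ + β * N₂) + onSnd I W * (1 + β * N₁ + β * N₂) +
        onFst J Z * (α - β) * N₂ := by
        rw [← f2]
        conv_lhs => enter [1]; rw [f1]
        noncomm_ring
    _ = _ := by
        rw [f3]
        noncomm_ring

theorem prodStep_lt (h : IsTransfer Z A r) (h' : IsTransfer W B r') (p q : I × J)
    (hpq : (prodStep Z W * scalar (I × J) b) p q ≠ 0) : r p.1 + r' p.2 < r q.1 + r' q.2 := by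
  have h0 : prodStep Z W p q ≠ 0 := fun h0 => hpq (by simp [scalar_apply, mul_diagonal, h0])
  by_contra hc
  refine h0 ?_
  have h1 : Z p.1 q.1 ≠ 0 → r p.1 < r q.1 := h.lt _ _
  have h2 : W p.2 q.2 ≠ 0 → r' p.2 < r' q.2 := h'.lt _ _
  rw [prodStep, of_apply]
  have h3 : (if p.2 = q.2 then Z p.1 q.1 else 0) = 0 := by
    rw [ite_eq_right_iff]
    intro he
    by_contra hz
    rw [he] at hc
    have := h1 hz
    omega
  have h4 : (if p.1 = q.1 then W p.2 q.2 else 0) = 0 := by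
    rw [ite_eq_right_iff]
    intro he
    by_contra hz
    rw [he] at hc
    have := h2 hz
    omega
  rw [h3, h4, zero_add, zero_add]
  by_cases hz : Z p.1 q.1 = 0
  · rw [hz, zero_mul, zero_mul]
  · by_cases hw : W p.2 q.2 = 0
    · rw [hw, mul_zero]
    · have := h1 hz
      have := h2 hw
      omega

theorem prodStep_swap (h : IsTransfer Z A r) (h' : IsTransfer W B r') (p q : I × J) :
    prodStep W Z p.swap q.swap = prodStep Z W p q := by
  have hc : W p.2 q.2 * (a - b) * Z p.1 q.1 = Z p.1 q.1 * (a - b) * W p.2 q.2 := by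
    rw [mul_assoc, mul_comm_of_mem (h'.mem _ _) (mul_mem sub_mem_diffAlg (h.mem _ _)),
      mul_comm_of_mem sub_mem_diffAlg (h.mem _ _)]
  simp only [prodStep, of_apply, Prod.fst_swap, Prod.snd_swap, hc]
  abel

/-- Entries of `Z` and `W` commute, so exchanging the factors preserves the step weights, and by
uniqueness the chain sums. -/
theorem mixing_comm (h : IsTransfer Z A r) (h' : IsTransfer W B r') (x y : I) (z w : J) :
    mixing (A x y) (B z w) = mixing (B z w) (A x y) := by
  have key : prodChains A B - (prodChains B A).submatrix Prod.swap Prod.swap = 0 := by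
    refine eq_zero_of_eq_mul (h.prodStep_lt h') ?_
    have h1 := h.prodChains_eq h'
    have h2 : (prodChains B A).submatrix Prod.swap Prod.swap = prodStep Z W +
        prodStep Z W * scalar (I × J) b * (prodChains B A).submatrix Prod.swap Prod.swap := by
      have hs : prodStep Z W = (prodStep W Z).submatrix Prod.swap Prod.swap := by
        ext p q
        exact (h.prodStep_swap h' p q).symm
      have hb : scalar (I × J) b = (scalar (J × I) b).submatrix Prod.swap Prod.swap :=
        (submatrix_diagonal_equiv (fun _ => b) (Equiv.prodComm I J)).symm
      conv_lhs => rw [h'.prodChains_eq h]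
      rw [hs, hb]
      erw [submatrix_mul_equiv _ _ _ (Equiv.prodComm I J),
        submatrix_mul_equiv _ _ _ (Equiv.prodComm I J)]
      rfl
    rw [mul_sub]
    conv_lhs => rw [h1, h2]
    abel
  have := congrFun (congrFun key (x, z)) (y, w)
  have h1 : prodChains A B (x, z) (y, w) = prodChains B A (z, x) (w, y) := sub_eq_zero.1 this
  simp only [prodChains, of_apply] at h1
  -- The boundary terms agree up to their order, so only the values of `M` remain.
  rw [add_right_comm] at h1
  exact add_right_cancel (add_right_cancel h1)

end IsTransfer

/-! ### The mixing operator is commutative -/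

/-- The entries of the matrices that satisfy `IsTransfer`. -/
def IsEntry (u : AB) : Prop :=
  ∃ (I : Type) (_ : Fintype I) (_ : DecidableEq I) (Z A : Matrix I I AB) (r : I → ℕ) (x y : I),
    IsTransfer Z A r ∧ A x y = u

/-- The extension of a square matrix by a first row, and by a zero column. -/
def addRow {I : Type*} (Z : Matrix I I AB) (ζ : I → AB) : Matrix (Option I) (Option I) AB :=
  of fun x y => match x, y with
    | _, none => 0
    | none, some y => ζ y
    | some x, some y => Z x y

theorem IsTransfer.addRow {I : Type*} [Fintype I] [DecidableEq I] {Z A : Matrix I I AB} {r : I → ℕ}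
    (h : IsTransfer Z A r) {ζ : I → AB} (hζ : ∀ y, ζ y ∈ diffAlg) :
    IsTransfer (addRow Z ζ) (addRow A fun y => ζ y + ∑ z, ζ z * b * A z y)
      (fun x => x.elim 0 fun x => r x + 1) where
  mem x y := by
    rcases x with _ | x <;> rcases y with _ | y
    · exact zero_mem _
    · exact hζ y
    · exact zero_mem _
    · exact h.mem x y
  lt x y hxy := by
    rcases x with _ | x <;> rcases y with _ | y
    · exact absurd rfl hxy
    · exact Nat.succ_pos _
    · exact absurd rfl hxy
    · exact Nat.succ_lt_succ (h.lt x y hxy)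
  eq := by
    ext x y
    rw [Matrix.add_apply, mul_scalar_mul_apply, Fintype.sum_option]
    rcases x with _ | x <;> rcases y with _ | y
    · simp [IntervalTransform.addRow]
    · simp [IntervalTransform.addRow]
    · simp [IntervalTransform.addRow]
    · simpa [IntervalTransform.addRow] using h.apply x y

theorem isEntry_one : IsEntry 1 := by
  have h : IsTransfer (0 : Matrix Unit Unit AB) 0 (fun _ => 0) :=
    ⟨fun _ _ => zero_mem _, fun _ _ h => absurd rfl h, by simp⟩
  exact ⟨_, _, _, _, _, _, none, some (), h.addRow (ζ := fun _ => 1) fun _ => one_mem _,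
    by simp [addRow]⟩

theorem IsEntry.b_mul {u : AB} (hu : IsEntry u) : IsEntry (b * u) := by
  obtain ⟨I, _, _, Z, A, r, x, y, h, rfl⟩ := hu
  by_cases hxy : x = y
  · subst hxy
    rw [h.eq_zero le_rfl, mul_zero]
    exact ⟨I, _, _, Z, A, r, x, x, h, h.eq_zero le_rfl⟩
  -- The new index steps only to `x`, with weight `1`; as `x ≠ y`, every chain to `y` then has `x`
  -- as an inner element, which gives the `b`.
  · refine ⟨_, _, _, _, _, _, none, some y,
      h.addRow (ζ := fun z => if z = x then 1 else 0) fun z => ?_, ?_⟩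
    · split_ifs
      exacts [one_mem _, zero_mem _]
    · simp [addRow, Ne.symm hxy]

/-- The new index copies the row of `x`, multiplied by `a - b`. -/
theorem IsEntry.sub_mul {u : AB} (hu : IsEntry u) : IsEntry ((a - b) * u) := by
  obtain ⟨I, _, _, Z, A, r, x, y, h, rfl⟩ := hu
  refine ⟨_, _, _, _, _, _, none, some y,
    h.addRow (ζ := fun z => (a - b) * Z x z) fun z => mul_mem sub_mem_diffAlg (h.mem x z), ?_⟩
  simp [addRow, h.apply x y, mul_add, Finset.mul_sum, mul_assoc]

theorem span_isEntry : Submodule.span ℚ {u | IsEntry u} = ⊤ := by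
  set S := Submodule.span ℚ {u | IsEntry u} with hS
  have hb : ∀ u ∈ S, b * u ∈ S := fun u hu =>
    (Submodule.span_le (p := S.comap (LinearMap.mulLeft ℚ b))).2
      (fun u hu => Submodule.subset_span (IsEntry.b_mul hu)) hu
  have ht : ∀ u ∈ S, (a - b) * u ∈ S := fun u hu =>
    (Submodule.span_le (p := S.comap (LinearMap.mulLeft ℚ (a - b)))).2
      (fun u hu => Submodule.subset_span (IsEntry.sub_mul hu)) hu
  have hw : ∀ w, word w ∈ S := by
    intro w
    induction w with
    | nil => exact Submodule.subset_span (by simpa [word] using isEntry_one)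
    | cons x w ih =>
      have h : word (x :: w) = FreeAlgebra.ι ℚ x * word w := by simp [word]
      rw [h]
      fin_cases x
      · have h2 : a * word w = (a - b) * word w + b * word w := by rw [sub_mul, sub_add_cancel]
        exact h2 ▸ add_mem (ht _ ih) (hb _ ih)
      · exact hb _ ih
  rw [eq_top_iff, ← wordBasis.span_eq, Submodule.span_le]
  rintro _ ⟨w, rfl⟩
  have := wordBasis_apply w.toList
  rw [FreeMonoid.ofList_toList] at this
  rw [this]
  exact hw _

theorem mixing_comm (u v : AB) : mixing u v = mixing v u := by
  have h : mixing = mixing.flip := by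
    refine LinearMap.ext_on span_isEntry fun u hu => LinearMap.ext_on span_isEntry fun v hv => ?_
    obtain ⟨I, _, _, Z, A, r, x, y, h, rfl⟩ := hu
    obtain ⟨J, _, _, W, B, r', z, w, h', rfl⟩ := hv
    exact h.mixing_comm h' x y z w
  exact LinearMap.congr_fun (LinearMap.congr_fun h u) v

theorem II_apply (u : AB) :
    II u = u + reversal u + TensorProduct.lift (mixing ∘ₗ reversal) (coproduct u) := rfl

/-- Reversing a word reverses and swaps the two tensor factors of Δ; commutativity of `M` undoes the
swap. -/
theorem lift_mixing_coproduct_reversal (u : AB) :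
    TensorProduct.lift (mixing ∘ₗ reversal) (coproduct (reversal u)) =
      TensorProduct.lift (mixing ∘ₗ reversal) (coproduct u) := by
  have h : TensorProduct.lift (mixing ∘ₗ reversal) ∘ₗ coproduct ∘ₗ reversal =
      TensorProduct.lift (mixing ∘ₗ reversal) ∘ₗ coproduct := by
    refine hom_ext_word fun w => ?_
    simp only [LinearMap.comp_apply, reversal_word, coproduct_word, map_sum,
      TensorProduct.lift.tmul, List.length_reverse]
    rw [← Finset.sum_range_reflect]
    refine Finset.sum_congr rfl fun i hi => ?_
    have hi := Finset.mem_range.1 hi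
    rw [mixing_comm, List.drop_reverse, List.take_reverse, List.reverse_reverse,
      show w.length - (w.length - 1 - i + 1) = i by omega,
      show w.length - (w.length - 1 - i) = i + 1 by omega]
  exact LinearMap.congr_fun h u

theorem II_eq_zero {u : AB} (hu : reversal u = -u) : II u = 0 := by
  have h := lift_mixing_coproduct_reversal u
  rw [hu, map_neg, map_neg] at h
  rw [II_apply, hu, add_neg_cancel, zero_add]
  exact self_eq_neg.1 h.symm

/-! ### The `ab`-index as a sum over chains -/

/-- The contribution to the `ab`-index of the ranks `k + 1, …, n` of a chain with set of ranks
`S`. -/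
def rankWeight (n k : ℕ) (S : Finset ℕ) : AB :=
  ((List.range (n - k)).map fun i => if k + i + 1 ∈ S then b else a - b).prod

theorem lift_word_rankWord (n : ℕ) (S : Finset ℕ) :
    FreeAlgebra.lift ℚ ![a - b, b] (word (rankWord n S)) = rankWeight n 0 S := by
  rw [word, rankWord, map_list_prod, List.map_map, List.map_map, rankWeight, Nat.sub_zero]
  congr 1
  refine List.map_congr_left fun i _ => ?_
  simp only [Function.comp_apply, FreeAlgebra.lift_ι_apply, zero_add]
  split_ifs <;> rfl

theorem rankWeight_of_forall_notMem {n k : ℕ} {S : Finset ℕ} (h : ∀ i ∈ S, ¬ (k < i ∧ i ≤ n)) :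
    rankWeight n k S = (a - b) ^ (n - k) := by
  rw [rankWeight, List.map_congr_left (g := fun _ => a - b)]
  · simp
  · intro i hi
    rw [if_neg]
    intro hc
    exact h _ hc ⟨by omega, by have := List.mem_range.1 hi; omega⟩

/-- The smallest rank `m` of a chain splits off the factors up to and including its `b`. -/
theorem rankWeight_insert {n k m : ℕ} {S : Finset ℕ} (hk : k < m) (hn : m ≤ n)
    (h : ∀ i ∈ S, m < i) :
    rankWeight n k (insert m S) = (a - b) ^ (m - k - 1) * b * rankWeight n m S := by
  have hl : n - k = (m - k - 1) + (1 + (n - m)) := by omega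
  rw [rankWeight, hl, List.range_add, List.map_append, List.prod_append, mul_assoc]
  congr 1
  · rw [List.map_congr_left (g := fun _ => a - b)]
    · simp
    · intro i hi
      have hi := List.mem_range.1 hi
      rw [if_neg]
      intro hc
      rcases Finset.mem_insert.1 hc with hc | hc
      · omega
      · have := h _ hc
        omega
  · rw [List.range_add, List.map_append, List.map_append, List.prod_append]
    congr 1
    · simp [show k + (m - k - 1) + 1 = m by omega]
    · rw [rankWeight]
      congr 1
      simp only [List.map_map]
      refine List.map_congr_left fun i _ => ?_
      simp only [Function.comp_apply, show k + (m - k - 1 + (1 + i)) + 1 = m + i + 1 by omega]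
      have : m + i + 1 ∈ insert m S ↔ m + i + 1 ∈ S := by simp [Finset.mem_insert]; omega
      simp only [this]

section Chains

variable {Q : Type*} [PartialOrder Q] [BoundedOrder Q] [Fintype Q]

open Classical in
/-- The chains of elements strictly between `x` and the maximum. -/
def chainsAbove (x : Q) : Finset (Finset Q) :=
  Finset.univ.filter fun C => IsChain (· ≤ ·) (C : Set Q) ∧ ∀ z ∈ C, x < z ∧ z < ⊤

theorem mem_chainsAbove {x : Q} {C : Finset Q} :
    C ∈ chainsAbove x ↔ IsChain (· ≤ ·) (C : Set Q) ∧ ∀ z ∈ C, x < z ∧ z < ⊤ := by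
  simp [chainsAbove]

theorem grade_bot_nat {Q : Type*} [PartialOrder Q] [BoundedOrder Q] [GradeMinOrder ℕ Q] :
    grade ℕ (⊥ : Q) = 0 :=
  Nat.le_zero.1 ((isMin_bot.grade ℕ) (Nat.zero_le _))

variable [GradeMinOrder ℕ Q]

theorem abIndex_eq_sum_chainsAbove :
    abIndex Q = ∑ C ∈ chainsAbove (⊥ : Q),
      rankWeight (grade ℕ (⊤ : Q) - 1) 0 (C.image (grade ℕ)) := by
  classical
  have hmaps : ∀ C ∈ chainsAbove (⊥ : Q), C.image (grade ℕ) ∈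
      (Finset.Icc 1 (grade ℕ (⊤ : Q) - 1)).powerset := by
    intro C hC
    rw [Finset.mem_powerset, Finset.image_subset_iff]
    intro z hz
    have h1 : grade ℕ (⊥ : Q) < grade ℕ z := grade_strictMono ((mem_chainsAbove.1 hC).2 z hz).1
    have h2 : grade ℕ z < grade ℕ (⊤ : Q) := grade_strictMono ((mem_chainsAbove.1 hC).2 z hz).2
    rw [Finset.mem_Icc]
    omega
  rw [← Finset.sum_fiberwise_of_maps_to hmaps, abIndex, upsilon, map_sum]
  refine Finset.sum_congr rfl fun S hS => ?_
  rw [map_smul, lift_word_rankWord]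
  rw [Finset.sum_congr rfl (g := fun _ => rankWeight (grade ℕ (⊤ : Q) - 1) 0 S)
    fun C hC => by rw [(Finset.mem_filter.1 hC).2], Finset.sum_const, ← Nat.cast_smul_eq_nsmul ℚ]
  congr 2
  rw [flagF, Nat.card_eq_fintype_card, Fintype.card_subtype]
  congr 1
  ext C
  simp only [Finset.mem_filter, Finset.mem_univ, true_and, mem_chainsAbove]
  constructor
  · rintro ⟨h1, h2⟩
    refine ⟨⟨h1, fun z hz => ?_⟩, h2⟩
    have h3 := Finset.mem_powerset.1 hS (h2 ▸ Finset.mem_image_of_mem (grade ℕ) hz)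
    rw [Finset.mem_Icc] at h3
    constructor
    · refine bot_lt_iff_ne_bot.2 ?_
      rintro rfl
      have := grade_bot_nat (Q := Q)
      omega
    · refine lt_top_iff_ne_top.2 ?_
      rintro rfl
      omega
  · rintro ⟨⟨h1, -⟩, h2⟩
    exact ⟨h1, h2⟩

-- A nonempty chain is its minimal element `y` together with a chain above `y`.
open Classical in
theorem sum_chainsAbove {Q : Type*} [PartialOrder Q] [BoundedOrder Q] [Fintype Q]
    {R : Type*} [AddCommMonoid R] (x : Q) (f : Finset Q → R) :
    ∑ C ∈ chainsAbove x, f C =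
      f ∅ + ∑ y : Q, if x < y ∧ y < ⊤ then ∑ C ∈ chainsAbove y, f (insert y C) else 0 := by
  have h0 : (∅ : Finset Q) ∈ chainsAbove x := mem_chainsAbove.2 ⟨by simp, by simp⟩
  rw [← Finset.add_sum_erase _ _ h0, ← Finset.sum_filter, Finset.sum_sigma']
  congr 1
  symm
  refine Finset.sum_bij (fun p _ => insert p.1 p.2) ?_ ?_ ?_ ?_
  · rintro ⟨y, C⟩ hp
    simp only [Finset.mem_sigma, Finset.mem_filter, Finset.mem_univ, true_and] at hp
    obtain ⟨⟨hxy, hy⟩, hC⟩ := hp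
    obtain ⟨h1, h2⟩ := mem_chainsAbove.1 hC
    refine Finset.mem_erase.2 ⟨Finset.insert_ne_empty _ _, mem_chainsAbove.2 ⟨?_, ?_⟩⟩
    · rw [Finset.coe_insert]
      exact h1.insert fun z hz _ => Or.inl (h2 z hz).1.le
    · intro z hz
      rcases Finset.mem_insert.1 hz with rfl | hz
      · exact ⟨hxy, hy⟩
      · exact ⟨hxy.trans (h2 z hz).1, (h2 z hz).2⟩
  · rintro ⟨y, C⟩ hp ⟨y', C'⟩ hp' h
    simp only [Finset.mem_sigma, Finset.mem_filter, Finset.mem_univ, true_and] at hp hp' h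
    have h2 := (mem_chainsAbove.1 hp.2).2
    have h2' := (mem_chainsAbove.1 hp'.2).2
    have hy : y = y' := by
      have e1 : y ∈ insert y' C' := h ▸ Finset.mem_insert_self _ _
      have e2 : y' ∈ insert y C := h ▸ Finset.mem_insert_self _ _
      rcases Finset.mem_insert.1 e1 with e1 | e1
      · exact e1
      · rcases Finset.mem_insert.1 e2 with e2 | e2
        · exact e2.symm
        · exact absurd ((h2' _ e1).1.trans (h2 _ e2).1) (lt_irrefl _)
    subst hy
    have n1 : y ∉ C := fun hc => lt_irrefl _ (h2 _ hc).1
    have n2 : y ∉ C' := fun hc => lt_irrefl _ (h2' _ hc).1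
    rw [← Finset.erase_insert n1, h, Finset.erase_insert n2]
  · intro C hC
    obtain ⟨hne, hC⟩ := Finset.mem_erase.1 hC
    obtain ⟨h1, h2⟩ := mem_chainsAbove.1 hC
    obtain ⟨y, hy⟩ := C.exists_minimal (Finset.nonempty_iff_ne_empty.2 hne)
    refine ⟨⟨y, C.erase y⟩, ?_, Finset.insert_erase hy.1⟩
    simp only [Finset.mem_sigma, Finset.mem_filter, Finset.mem_univ, true_and]
    refine ⟨h2 y hy.1, mem_chainsAbove.2 ⟨h1.mono (by simp), fun z hz => ⟨?_, ?_⟩⟩⟩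
    · obtain ⟨hz1, hz2⟩ := Finset.mem_erase.1 hz
      refine lt_of_le_of_ne ?_ hz1.symm
      rcases h1.total hy.1 hz2 with h | h
      · exact h
      · exact hy.2 hz2 h
    · exact (h2 z (Finset.mem_of_mem_erase hz)).2
  · intros
    rfl

open Classical in
/-- The `ab`-index is computed by a recursion over the first elements of chains. -/
theorem abIndex_eq_of_recursion (hQ : grade ℕ (⊤ : Q) ≠ 0) (F : Q → AB)
    (hF : ∀ x, x < ⊤ → F x = (a - b) ^ (grade ℕ (⊤ : Q) - grade ℕ x - 1) +
      ∑ y, if x < y ∧ y < ⊤ then (a - b) ^ (grade ℕ y - grade ℕ x - 1) * b * F y else 0) :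
    abIndex Q = F ⊥ := by
  -- `F x` must be the sum over chains above `x`, weighted only at ranks beyond that of `x`.
  have key : ∀ x : Q, x < ⊤ → ∑ C ∈ chainsAbove x,
      rankWeight (grade ℕ (⊤ : Q) - 1) (grade ℕ x) (C.image (grade ℕ)) = F x := by
    intro x
    induction x using WellFoundedGT.induction with
    | ind x ih =>
      intro hx
      rw [sum_chainsAbove, hF x hx]
      congr 1
      · rw [rankWeight_of_forall_notMem (by simp)]
        congr 1
        omega
      · refine Finset.sum_congr rfl fun y _ => ?_
        split_ifs with hy
        · rw [← ih y hy.1 hy.2, Finset.mul_sum]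
          refine Finset.sum_congr rfl fun C hC => ?_
          have h1 : grade ℕ x < grade ℕ y := grade_strictMono hy.1
          have h2 : grade ℕ y < grade ℕ (⊤ : Q) := grade_strictMono hy.2
          rw [Finset.image_insert, rankWeight_insert h1 (by omega)]
          intro i hi
          obtain ⟨z, hz, rfl⟩ := Finset.mem_image.1 hi
          exact grade_strictMono ((mem_chainsAbove.1 hC).2 z hz).1
        · rfl
  have hlt : (⊥ : Q) < ⊤ := by
    refine lt_top_iff_ne_top.2 fun h => hQ ?_
    rw [← h, grade_bot_nat]
  rw [abIndex_eq_sum_chainsAbove, ← key ⊥ hlt, grade_bot_nat]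

end Chains

/-! ### The total `ab`-index -/

section Total

variable {P : Type*} [PartialOrder P] [GradeMinOrder ℕ P]

open Classical in
/-- The weights of the steps of chains of a graded poset. -/
def orderStep (P : Type*) [PartialOrder P] [GradeMinOrder ℕ P] : Matrix P P AB :=
  of fun x y => if x < y then (a - b) ^ (grade ℕ y - grade ℕ x - 1) else 0

theorem orderStep_of_lt {x y : P} (h : x < y) :
    orderStep P x y = (a - b) ^ (grade ℕ y - grade ℕ x - 1) := by
  rw [orderStep, of_apply, if_pos h]

theorem orderStep_of_not_lt {x y : P} (h : ¬ x < y) : orderStep P x y = 0 := by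
  rw [orderStep, of_apply, if_neg h]

open Classical in
/-- The step weight from the interval `[u, v]` to the interval `[u', v']`. -/
theorem prodStep_orderStep [DecidableEq P] (p q : P × P) :
    prodStep (orderStep P)ᵀ (orderStep P) p q =
      if (q.1 ≤ p.1 ∧ p.2 ≤ q.2) ∧ p ≠ q then
        (a - b) ^ ((grade ℕ p.1 - grade ℕ q.1) + (grade ℕ q.2 - grade ℕ p.2) - 1) else 0 := by
  obtain ⟨u, v⟩ := p
  obtain ⟨u', v'⟩ := q
  simp only [prodStep, of_apply, transpose_apply]
  by_cases hu : u' < u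
  · have gu : grade ℕ u' < grade ℕ u := grade_strictMono hu
    by_cases hv : v < v'
    · have gv : grade ℕ v < grade ℕ v' := grade_strictMono hv
      -- Exponents `i - 1` and `j - 1` add up to one less than `i + j - 1`; the middle factor `a -
      -- b` makes up for it.
      rw [if_neg hv.ne, if_neg hu.ne', if_pos ⟨⟨hu.le, hv.le⟩, by simp [hu.ne']⟩,
        orderStep_of_lt hu, orderStep_of_lt hv, zero_add, zero_add, ← pow_succ, ← pow_add]
      congr 1
      omega
    · rw [orderStep_of_not_lt hv, orderStep_of_lt hu, if_neg hu.ne', mul_zero, add_zero, add_zero]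
      by_cases hv' : v = v'
      · rw [if_pos hv', if_pos ⟨⟨hu.le, hv'.le⟩, by simp [hu.ne']⟩, hv', Nat.sub_self, add_zero]
      · rw [if_neg hv', if_neg]
        rintro ⟨⟨-, h⟩, -⟩
        exact hv (lt_of_le_of_ne h hv')
  · rw [orderStep_of_not_lt hu, ite_self, zero_mul, zero_mul, add_zero, zero_add]
    by_cases hu' : u = u'
    · subst hu'
      rw [if_pos rfl]
      by_cases hv : v < v'
      · rw [orderStep_of_lt hv, if_pos ⟨⟨le_rfl, hv.le⟩, by simp [hv.ne]⟩, Nat.sub_self, zero_add]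
      · rw [orderStep_of_not_lt hv, if_neg]
        rintro ⟨⟨-, h⟩, hne⟩
        exact hv (lt_of_le_of_ne h fun h2 => hne (by rw [h2]))
    · rw [if_neg hu', if_neg]
      rintro ⟨⟨h, -⟩, -⟩
      exact hu (lt_of_le_of_ne h (Ne.symm hu'))

/-- The end points of an interval; the value at the empty interval is irrelevant. -/
def endPoints [BoundedOrder P] : Interval P → P × P
  | none => (⊤, ⊥)
  | some s => s.toProd

theorem exists_eq_coe_of_pure_le {P : Type*} [PartialOrder P] {x : P} {I : Interval P}
    (hI : Interval.pure x ≤ I) :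
    ∃ s : NonemptyInterval P, I = s ∧ s.fst ≤ x ∧ x ≤ s.snd := by
  induction I using Interval.recBotCoe with
  | bot => exact absurd (le_bot_iff.1 hI) (WithBot.coe_ne_bot)
  | coe s => exact ⟨s, rfl, (coe_le_coe_iff (NonemptyInterval.pure x) s).1 hI⟩

theorem exists_isTransfer_orderStep (P : Type*) [PartialOrder P] [GradeMinOrder ℕ P] [Fintype P]
    [DecidableEq P] :
    ∃ A, IsTransfer (orderStep P) A (grade ℕ) := by
  refine exists_isTransfer (fun x y => ?_) fun x y h => ?_
  · by_cases h : x < y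
    · rw [orderStep_of_lt h]
      exact pow_mem sub_mem_diffAlg _
    · rw [orderStep_of_not_lt h]
      exact zero_mem _
  · by_contra hc
    exact h (orderStep_of_not_lt fun hxy => hc (grade_strictMono hxy))

theorem finite_interval (P : Type*) [PartialOrder P] [Finite P] : Finite (Interval P) := by
  have h : Finite (NonemptyInterval P) :=
    Finite.of_injective (fun s => s.toProd) NonemptyInterval.toProd_injective
  exact inferInstanceAs (Finite (Option (NonemptyInterval P)))

variable [BoundedOrder P]

theorem grade_Icc_pure {x : P} {I : Set.Icc (Interval.pure x) (⊤ : Interval P)}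
    {s : NonemptyInterval P} (hs : (I : Interval P) = s) :
    grade ℕ I = grade ℕ s.snd - grade ℕ s.fst := by
  have h : grade ℕ I = intervalRank (I : Interval P) - intervalRank (Interval.pure x) := rfl
  have hx : intervalRank (Interval.pure x) = grade ℕ x - grade ℕ x + 1 := rfl
  rw [h, hs, intervalRank_coe, hx]
  omega

/-- A function on pairs that satisfies the recursion for chains of a product of the dual of `P` and
`P` computes the `ab`-index of the intervals `[[x, x], [0̂, 1̂]]`. -/
theorem abIndex_Icc_pure_of_recursion [Fintype P] [DecidableEq P]
    (hP : grade ℕ (⊤ : P) ≠ 0) (V : P × P → AB)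
    (hV : ∀ p, V p = prodStep (orderStep P)ᵀ (orderStep P) p (⊥, ⊤) +
      ∑ q, prodStep (orderStep P)ᵀ (orderStep P) p q * b * V q)
    (hV₀ : V (⊥, ⊤) = 0) (x : P) :
    abIndex (Set.Icc (Interval.pure x) (⊤ : Interval P)) = V (x, x) := by
  classical
  have := finite_interval P
  have : Fintype (Set.Icc (Interval.pure x) (⊤ : Interval P)) := Fintype.ofFinite _
  have hm : Monotone (grade ℕ : P → ℕ) := grade_strictMono.monotone
  have key := abIndex_eq_of_recursion (Q := Set.Icc (Interval.pure x) (⊤ : Interval P))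
    (by rwa [grade_top_Icc_pure]) (fun I => V (endPoints (I : Interval P))) ?_
  · rw [key]
    rfl
  intro I hI
  obtain ⟨s, hs, hu, hv⟩ := exists_eq_coe_of_pure_le I.2.1
  have hIs : endPoints (I : Interval P) = (s.fst, s.snd) := by rw [hs]; rfl
  have gs := hm s.fst_le_snd
  have gt := hm (le_top (a := s.snd))
  have gb := grade_bot_nat (Q := P)
  have hne : (s.fst, s.snd) ≠ (⊥, ⊤) := by
    intro h
    rw [Prod.mk.injEq] at h
    refine hI.ne (Subtype.ext ?_)
    rw [hs]
    exact congrArg WithBot.some (NonemptyInterval.ext (Prod.ext h.1 h.2))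
  rw [hIs, hV, prodStep_orderStep, if_pos ⟨⟨bot_le, le_top⟩, hne⟩, grade_top_Icc_pure,
    grade_Icc_pure hs]
  congr 1
  · congr 1
    simp only
    omega
  symm
  -- The sum over all pairs reduces to intervals containing `x`: a pair reached from `I` with
  -- nonzero weight has end points on both sides of `x`.
  refine Fintype.sum_of_injective (fun J : Set.Icc (Interval.pure x) (⊤ : Interval P) =>
    endPoints (J : Interval P)) ?_ _ _ ?_ ?_
  · intro J K hJK
    obtain ⟨t, ht, -, -⟩ := exists_eq_coe_of_pure_le J.2.1
    obtain ⟨t', ht', -, -⟩ := exists_eq_coe_of_pure_le K.2.1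
    refine Subtype.ext ?_
    simp only [ht, ht'] at hJK ⊢
    exact congrArg WithBot.some (NonemptyInterval.ext hJK)
  · rintro ⟨u', v'⟩ hq
    rw [prodStep_orderStep, if_neg, zero_mul, zero_mul]
    rintro ⟨⟨h1, h2⟩, -⟩
    have h3 : u' ≤ x := h1.trans hu
    have h4 : x ≤ v' := hv.trans h2
    refine hq ⟨⟨((⟨(u', v'), h3.trans h4⟩ : NonemptyInterval P) : Interval P), ?_, le_top⟩, rfl⟩
    exact (coe_le_coe_iff (NonemptyInterval.pure x) _).2 ⟨h3, h4⟩
  · intro J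
    obtain ⟨t, ht, -, -⟩ := exists_eq_coe_of_pure_le J.2.1
    have hJt : endPoints (J : Interval P) = (t.fst, t.snd) := by rw [ht]; rfl
    have hle : I ≤ J ↔ t.fst ≤ s.fst ∧ s.snd ≤ t.snd := by
      rw [← Subtype.coe_le_coe, hs, ht, coe_le_coe_iff]
    have heq : I = J ↔ (s.fst, s.snd) = (t.fst, t.snd) := by
      rw [← hIs, ← hJt]
      refine ⟨fun h => by rw [h], fun h => Subtype.ext ?_⟩
      rw [hs, ht] at h ⊢
      exact congrArg WithBot.some (NonemptyInterval.ext h)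
    -- The matrix recursion also sums over the maximum, which chains omit; `hV₀` removes that term.
    by_cases hJ : J = ⊤
    · have : endPoints (J : Interval P) = (⊥, ⊤) := by rw [hJ]; rfl
      simp only [this, hV₀, mul_zero, ite_self]
    · have hJ' : J < ⊤ := lt_top_iff_ne_top.2 hJ
      simp only [hJ', and_true, lt_iff_le_and_ne, ne_eq, hJt, prodStep_orderStep, hle, heq,
        grade_Icc_pure ht]
      split_ifs with hc
      · have g1 := hm hc.1.1
        have g2 := hm hc.1.2
        have g3 := hm t.fst_le_snd
        congr 3
        omega
      · rw [zero_mul, zero_mul]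

variable [Fintype P]

theorem abIndex_Icc_pure [DecidableEq P] {A B : Matrix P P AB} {r : P → ℕ}
    (hP : grade ℕ (⊤ : P) ≠ 0) (h : IsTransfer (orderStep P) A (grade ℕ))
    (h' : IsTransfer (orderStep P)ᵀ B r) (x : P) :
    abIndex (Set.Icc (Interval.pure x) (⊤ : Interval P)) = prodChains B A (x, x) (⊥, ⊤) := by
  refine abIndex_Icc_pure_of_recursion hP (fun p => prodChains B A p (⊥, ⊤)) (fun p => ?_) ?_ x
  · have := congrFun (congrFun (h'.prodChains_eq h) p) (⊥, ⊤)
    rw [Matrix.add_apply, mul_scalar_mul_apply] at this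
    exact this
  · simp [prodChains, h.eq_zero le_rfl, h'.eq_zero le_rfl]

theorem abIndex_eq_transfer [DecidableEq P] {A : Matrix P P AB}
    (h : IsTransfer (orderStep P) A (grade ℕ)) (hP : grade ℕ (⊤ : P) ≠ 0) :
    abIndex P = A ⊥ ⊤ := by
  refine abIndex_eq_of_recursion hP (fun x => A x ⊤) fun x hx => ?_
  rw [h.apply, orderStep_of_lt hx]
  congr 1
  refine Finset.sum_congr rfl fun y _ => ?_
  split_ifs with hy
  · rw [orderStep_of_lt hy.1]
  · by_cases h1 : x < y
    -- Here `y = ⊤`, and diagonal entries of `A` vanish.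
    · rw [h.eq_zero (grade_strictMono.monotone (not_lt_top_iff.1 fun h2 => hy ⟨h1, h2⟩).ge), mul_zero]
    · rw [orderStep_of_not_lt h1, zero_mul, zero_mul]

theorem totalABIndex_eq (hP : grade ℕ (⊤ : P) ≠ 0) : totalABIndex P = II (abIndex P) := by
  classical
  obtain ⟨A, h⟩ := exists_isTransfer_orderStep P
  have h' := h.dual (s := fun x => grade ℕ (⊤ : P) - grade ℕ x) fun x y hxy => by
    have : grade ℕ y ≤ grade ℕ (⊤ : P) := grade_strictMono.monotone le_top
    omega
  rw [totalABIndex, abIndex_eq_transfer h hP, II_apply, h.coproduct_apply, map_sum]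
  simp only [abIndex_Icc_pure hP h h', prodChains, of_apply, transpose_apply, map_apply,
    Finset.sum_add_distrib]
  -- The boundary terms survive only at `x = ⊤` and `x = ⊥`, where they give `u*` and `u`.
  simp only [Finset.sum_ite_eq', Finset.mem_univ, if_true, TensorProduct.lift.tmul,
    LinearMap.comp_apply]
  abel

end Total

end IntervalTransform

end

theorem mainTheorem8 :
    (∀ (P : Type*) [PartialOrder P] [BoundedOrder P] [Fintype P] [GradeMinOrder ℕ P] (n : ℕ),
      grade ℕ (⊤ : P) = n + 1 →
        IntervalTransform.totalABIndex P = IntervalTransform.II (IntervalTransform.abIndex P)) ∧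
    (∀ u : IntervalTransform.AB, IntervalTransform.reversal u = -u → IntervalTransform.II u = 0) := by
  refine ⟨?_, fun u hu => IntervalTransform.II_eq_zero hu⟩
  intro P _ _ _ _ n hn
  exact IntervalTransform.totalABIndex_eq (by omega)
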